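/- **Littlewood–Richardson coefficients are quiver coefficients.** Identify a partition with its Young diagram; $\ell(\lambda)$ is the number of nonzero parts of $\lambda$ and $|\lambda|$ its size. Let $c^\gamma_{\alpha,\beta}$ be the Littlewood–Richardson coefficient, i.e. the coefficient of the Schur function $s_\gamma$ in the expansion of $s_\alpha s_\beta$, where $s_\lambda=\det(h_{\lambda_i+j-i})$ in $\mathbb Z[h_1,h_2,\dots]$, with $h_0=1$ and $h_k=0$ for $k<0$. *Quiver coefficients.* Let $n\ge 1$ and let $r=(r_{ij})_{0\le i\le j\le n}$ be non-negative integers with $r_{ij}\le r_{i,j-1}$ and $r_{ij}\le r_{i+1,j}$ for $i<j$, and $r_{i+1,j-1}-r_{i,j-1}-r_{i+1,j}+r_{ij}\ge 0$ for $i<j-1$ (rank conditions). For $i<j$ let $R_{ij}$ be the rectangle of width $r_{i,j-1}-r_{ij}$ and height $r_{i+1,j}-r_{ij}$. The integers $c_\lambda(r)$, for $\lambda=(\lambda(1),\dots,\lambda(n))$ an $n$-tuple of partitions, are defined through a formal sum $\sum_\lambda c_\lambda(r)\,S(\lambda)$ by induction on $n$. For $n=1$ the sum is $S(R_{01})$.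 For $n\ge 2$, let $\sum_\mu d_\mu S(\mu)$ be the sum for $r'=(r_{i,j+1})_{0\le i\le j\le n-1}$ (that is, the array of rectangles with its top row $R_{01},R_{12},\dots,R_{n-1,n}$ deleted), and put $$\sum_\lambda c_\lambda(r)S(\lambda)=\sum_\mu d_\mu\sum_{\sigma,\tau}\Big(\prod_{i=1}^{n-1}c^{\mu(i)}_{\sigma(i),\tau(i)}\Big)S(I(1),\dots,I(n)),$$ where the inner sum is over partitions $\sigma(1),\dots,\sigma(n-1)$, $\tau(1),\dots,\tau(n-1)$ with $|\sigma(i)|+|\tau(i)|=|\mu(i)|$ and $\ell(\sigma(i))$ at most the height of $R_{i-1,i}$, where $\sigma(n)=\tau(0)=\emptyset$, and where $I(i)=(e+\sigma(i)_1,\dots,e+\sigma(i)_f,\tau(i-1)_1,\tau(i-1)_2,\dots)$ for $R_{i-1,i}$ of width $e$ and height $f$. A symbol $S(I(1),\dots,I(n))$ is rewritten, entry by entry, by moves $(\dots,a,b,\dots)\mapsto(\dots,b-1,a+1,\dots)$ on adjacent entries $a<b$, each of which changes the sign, until all entries are partitions (trailing zeros are ignored); it is $0$ if on the way some entry has adjacent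 terms $a,a+1$. *Claim.* Let $\alpha,\beta,\gamma$ be partitions, let $R$ be a rectangle of height $h\ge 0$ and width $w\ge 0$ containing $\gamma$, and let $\tau$ be the complement of $\gamma$ in $R$, rotated by $180^\circ$. Then there are rank conditions $r$ with $n=3$ whose array of rectangles $$\begin{matrix}R_{01}&&R_{12}&&R_{23}\\&R_{02}&&R_{13}&\\&&R_{03}&&\end{matrix}$$ has $R_{03}=R$ (height $h$, width $w$), $R_{01}$ and $R_{02}$ of height $h$ and width $0$, $R_{13}$ and $R_{23}$ of height $0$ and width $w$, and $R_{12}$ of height $0$ and width $0$; and for every such $r$ $$c^\gamma_{\alpha,\beta}=c_\lambda(r)\qquad\text{with }\lambda=(\alpha,\beta,\tau).$$ -/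

import Mathlib

/-! Partitions are Young diagrams `l : YoungDiagram`: the parts are `l.rowLen 0 ≥ l.rowLen 1 ≥ …`,
the length (number of nonzero parts) is `l.colLen 0`, the size is `l.card`, and the empty partition
is `⊥`. -/

noncomputable section

namespace QuiverLR

/-- The rectangle of height `h` and width `w`, i.e. the partition `(w, …, w)` with `h` parts. -/
def rect (h w : ℕ) : YoungDiagram where
  cells := Finset.range h ×ˢ Finset.range w
  isLowerSet := by
    rintro ⟨i, j⟩ ⟨i', j'⟩ hle hmem
    simp only [Prod.mk_le_mk] at hle
    simp only [Finset.coe_product, Finset.coe_range, Set.mem_prod, Set.mem_Iio] at hmem ⊢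
    omega

/-- The complement of `g` in the rectangle of height `h` and width `w`, rotated by 180 degrees:
the box `(i, j)` of the rectangle is kept when the opposite box `(h-1-i, w-1-j)` is not in `g`. -/
def rotCompl (h w : ℕ) (g : YoungDiagram) : YoungDiagram where
  cells := (Finset.range h ×ˢ Finset.range w).filter
    (fun c => (h - 1 - c.1, w - 1 - c.2) ∉ g)
  isLowerSet := by
    rintro ⟨i, j⟩ ⟨i', j'⟩ hle hmem
    simp only [Prod.mk_le_mk] at hle
    simp only [Finset.coe_filter, Finset.mem_product, Finset.mem_range, Set.mem_ofPred_eq]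
      at hmem ⊢
    refine ⟨by omega, fun hc => hmem.2 ?_⟩
    exact g.up_left_mem (by omega) (by omega) hc

/-! ### Schur functions and Littlewood-Richardson coefficients -/

/-- The complete symmetric functions `h_k`, for `k : ℤ`, in the ring of symmetric functions
`ℤ[h_1, h_2, …]`: here `h_k = 0` for `k < 0`, `h_0 = 1`, and `h_{k+1}` is the variable `X k`. -/
def completeH : ℤ → MvPolynomial ℕ ℤ
  | Int.ofNat 0 => 1
  | Int.ofNat (k + 1) => MvPolynomial.X k
  | Int.negSucc _ => 0

/-- The Schur function `s_l = det (h_{l_i + j - i})`, with `1 ≤ i, j ≤ length of l`. -/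
def schur (l : YoungDiagram) : MvPolynomial ℕ ℤ :=
  Matrix.det (Matrix.of fun i j : Fin (l.colLen 0) =>
    completeH ((l.rowLen i : ℤ) + (j : ℤ) - (i : ℤ)))

open Classical in
/-- The Littlewood-Richardson coefficient `c^g_{a,b}`: the coefficient of `s_g` in the expansion of
`s_a * s_b` as an integer combination of Schur functions. (The Schur functions are a `ℤ`-basis of
`ℤ[h_1, h_2, …]`, so the expansion exists and is unique.) -/
def lrCoeff (g a b : YoungDiagram) : ℤ :=
  if hc : ∃ c : YoungDiagram →₀ ℤ, schur a * schur b = c.sum (fun l z => z • schur l)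
  then hc.choose g else 0

/-! ### The straightening rule for symbols `S(I)` -/

/-- `StraightensIn I m J`: the sequence `J` is obtained from `I` by `m` successive moves
`(…, a, b, …) ↦ (…, b - 1, a + 1, …)` with `a < b`, where `a, b` are adjacent entries. -/
inductive StraightensIn : List ℕ → ℕ → List ℕ → Prop
  | refl (I : List ℕ) : StraightensIn I 0 I
  | move (u v J : List ℕ) (a b m : ℕ) (hab : a < b)
      (hJ : StraightensIn (u ++ (b - 1) :: (a + 1) :: v) m J) :
      StraightensIn (u ++ a :: b :: v) (m + 1) J

open Classical in
/-- The coefficient of `S(l)` in the symbol `S(I)`: it is `(-1)^m` if `I` reaches the partition `l`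
(possibly followed by zeros) in `m` moves, and `0` if `I` does not reach `l`. (The moves permute
the set with multiplicities of the numbers `I_k - k`, so at most one partition is reached and the
parity of `m` is determined; if two adjacent entries `a, a + 1` occur on the way then two of these
numbers coincide and no partition is reached.) -/
def straightenCoeff (I : List ℕ) (l : YoungDiagram) : ℤ :=
  if hm : ∃ m k : ℕ, StraightensIn I m (l.rowLens ++ List.replicate k 0)
  then (-1) ^ hm.choose else 0

/-! ### Rank conditions and the quiver coefficients -/

/-- The rank conditions `r = (r i j)`, `0 ≤ i ≤ j ≤ n`, that can occur for sequences of `n`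
composable maps; `r i i` is the rank of the `i`-th bundle. -/
def IsRankCondition (n : ℕ) (r : ℕ → ℕ → ℕ) : Prop :=
  (∀ i j, i < j → j ≤ n → r i j ≤ r i (j - 1) ∧ r i j ≤ r (i + 1) j) ∧
  (∀ i j, i + 1 < j → j ≤ n →
    0 ≤ (r (i + 1) (j - 1) : ℤ) - r i (j - 1) - r (i + 1) j + r i j)

/-- The width of the rectangle `R_{ij}`, for `i < j`. -/
def rectWidth (r : ℕ → ℕ → ℕ) (i j : ℕ) : ℕ := r i (j - 1) - r i j

/-- The height of the rectangle `R_{ij}`, for `i < j`. -/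
def rectHeight (r : ℕ → ℕ → ℕ) (i j : ℕ) : ℕ := r (i + 1) j - r i j

/-- The sequence `(e + s_1, …, e + s_f, t_1, t_2, …)`: the partition `s` is put to the right of
the rectangle of height `f` and width `e`, and the partition `t` is put below it. -/
def attachSeq (f e : ℕ) (s t : YoungDiagram) : List ℕ :=
  (List.range f).map (fun i => e + s.rowLen i) ++ t.rowLens

open Classical in
/-- The coefficient `c_l(r)` of `S(l(1), …, l(n))` in the formal sum attached to the rank
conditions `r`, by the inductive algorithm. The entry `l k` (`k : Fin n`) is `l(k+1)`, and likewise
for `mu`, `s`, `t`. Deleting the top row of the rectangular array of `r` gives the rectangular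
array of `fun i j => r i (j + 1)`. The two families below are `s(1), …, s(n-1), s(n) = ∅` and
`t(0) = ∅, t(1), …, t(n-1)`. Only finitely many terms of the sums are nonzero. (For `n = 0` the
formal sum is the empty symbol, with coefficient `1`.) -/
def quiverCoeff : (n : ℕ) → (r : ℕ → ℕ → ℕ) → (Fin n → YoungDiagram) → ℤ
  | 0, _, _ => 1
  | 1, r, l => if l 0 = rect (rectHeight r 0 1) (rectWidth r 0 1) then 1 else 0
  | n + 2, r, l =>
      ∑ᶠ (mu : Fin (n + 1) → YoungDiagram) (s : Fin (n + 1) → YoungDiagram)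
        (t : Fin (n + 1) → YoungDiagram),
        if ∀ i : Fin (n + 1), (s i).card + (t i).card = (mu i).card ∧
            (s i).colLen 0 ≤ rectHeight r i (i + 1) then
          quiverCoeff (n + 1) (fun i j => r i (j + 1)) mu *
            (∏ i : Fin (n + 1), lrCoeff (mu i) (s i) (t i)) *
            ∏ k : Fin (n + 2), straightenCoeff
              (attachSeq (rectHeight r k (k + 1)) (rectWidth r k (k + 1))
                ((Fin.snoc s ⊥ : Fin (n + 2) → YoungDiagram) k)
                ((Fin.cons ⊥ t : Fin (n + 2) → YoungDiagram) k))
              (l k)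
        else 0

/-- `r` is a set of rank conditions (for `n = 3`) whose rectangular array is
```
  |   .   -
    |   -
      R
```
where `R` is the rectangle of height `h` and width `w`, each `|` has height `h` and width `0`, each
`-` has height `0` and width `w`, and the dot has height and width `0`. -/
structure RealizesArray (h w : ℕ) (r : ℕ → ℕ → ℕ) : Prop where
  rank : IsRankCondition 3 r
  R01 : rectHeight r 0 1 = h ∧ rectWidth r 0 1 = 0
  R12 : rectHeight r 1 2 = 0 ∧ rectWidth r 1 2 = 0
  R23 : rectHeight r 2 3 = 0 ∧ rectWidth r 2 3 = w
  R02 : rectHeight r 0 2 = h ∧ rectWidth r 0 2 = 0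
  R13 : rectHeight r 1 3 = 0 ∧ rectWidth r 1 3 = w
  R03 : rectHeight r 0 3 = h ∧ rectWidth r 0 3 = w

end QuiverLR

end

namespace QuiverLR

/-! ### Young diagrams and their rows -/

/-! Unfold the algorithm. Each top-row rectangle, at both stages, has width 0 or height 0. A
height-0 rectangle leaves just the partition below it. A width-0 one has nothing below it, so it
gives a partition padded by zeros. Hence no symbol needs straightening. Starting from `S(R)`, the `n
= 2` stage gives `(μ(1), μ(2))` the coefficient `c^R_{μ(1),μ(2)}`, which is 1 if the two are
complementary in `R` and 0 otherwise (`lrCoeff_rect`). At the `n = 3` stage the height of `R_{12}`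
forces `σ(2) = ∅`, so `τ(2) = μ(2)`. Prescribing `τ` as third entry thus forces `μ(1) = γ`, and
splitting `γ` into `(α, β)` contributes exactly `c^γ_{α,β}`.

The facts about Littlewood-Richardson coefficients come from specializing to finitely many
variables. The bialternant formula turns Schur functions into alternants, and coefficients of
alternants at strictly decreasing exponents are 0 or 1. This gives uniqueness of expansions;
existence is a triangularity argument (`span_schur_eq_top`). The rectangle case is an orthogonality
relation: the coefficient of a power of `x_1 ⋯ x_h` in a product of two alternants detects
complementary partitions. -/

theorem rowLen_pos_iff {l : YoungDiagram} {i : ℕ} : 0 < l.rowLen i ↔ i < l.colLen 0 := by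
  rw [← YoungDiagram.mem_iff_lt_rowLen, YoungDiagram.mem_iff_lt_colLen]

theorem rowLen_eq_zero {l : YoungDiagram} {i : ℕ} (hi : l.colLen 0 ≤ i) : l.rowLen i = 0 := by
  by_contra hne
  exact absurd (rowLen_pos_iff.1 (Nat.pos_of_ne_zero hne)) (by omega)

theorem ext_rowLen {a b : YoungDiagram} (hab : ∀ i, a.rowLen i = b.rowLen i) : a = b := by
  ext ⟨i, j⟩
  rw [YoungDiagram.mem_cells, YoungDiagram.mem_cells, YoungDiagram.mem_iff_lt_rowLen,
    YoungDiagram.mem_iff_lt_rowLen, hab]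

theorem ext_rowLen_of_le {a b : YoungDiagram} {n : ℕ} (ha : a.colLen 0 ≤ n) (hb : b.colLen 0 ≤ n)
    (hab : ∀ i < n, a.rowLen i = b.rowLen i) : a = b := by
  refine ext_rowLen fun i => ?_
  rcases lt_or_ge i n with hi | hi
  · exact hab i hi
  · rw [rowLen_eq_zero (ha.trans hi), rowLen_eq_zero (hb.trans hi)]

@[simp] theorem rowLen_bot (i : ℕ) : (⊥ : YoungDiagram).rowLen i = 0 := by
  by_contra hne
  exact YoungDiagram.notMem_bot _ (YoungDiagram.mem_iff_lt_rowLen.2 (Nat.pos_of_ne_zero hne))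

@[simp] theorem colLen_bot (i : ℕ) : (⊥ : YoungDiagram).colLen i = 0 := by
  by_contra hne
  exact YoungDiagram.notMem_bot _ (YoungDiagram.mem_iff_lt_colLen.2 (Nat.pos_of_ne_zero hne))

theorem eq_bot_of_colLen {l : YoungDiagram} (hl : l.colLen 0 ≤ 0) : l = ⊥ :=
  ext_rowLen fun i => by rw [rowLen_eq_zero (by omega), rowLen_bot]

theorem card_eq_sum_rowLen {l : YoungDiagram} {n : ℕ} (hl : l.colLen 0 ≤ n) :
    l.card = ∑ i : Fin n, l.rowLen i := by
  rw [Fin.sum_univ_eq_sum_range (fun i => l.rowLen i)]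
  rw [YoungDiagram.card, Finset.card_eq_sum_card_fiberwise (f := Prod.fst) (t := Finset.range n)]
  · exact Finset.sum_congr rfl fun i _ => (YoungDiagram.rowLen_eq_card l).symm
  · rintro ⟨i, j⟩ hc
    have : j < l.rowLen i := YoungDiagram.mem_iff_lt_rowLen.1 (by simpa using hc)
    have := rowLen_pos_iff.1 (Nat.zero_lt_of_lt this)
    simp only [Finset.coe_range, Set.mem_Iio]
    omega

theorem mem_rect {h w i j : ℕ} : (i, j) ∈ rect h w ↔ i < h ∧ j < w := by
  rw [← YoungDiagram.mem_cells]; simp [rect]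

theorem rowLen_rect {h w i : ℕ} (hi : i < h) : (rect h w).rowLen i = w := by
  have key : ∀ j, j < (rect h w).rowLen i ↔ j < w := fun j => by
    rw [← YoungDiagram.mem_iff_lt_rowLen, mem_rect]; simp [hi]
  have h1 := key w
  have h2 := key ((rect h w).rowLen i)
  omega

theorem colLen_rect_le {h w : ℕ} : (rect h w).colLen 0 ≤ h := by
  by_contra hlt
  have := (mem_rect.1 ((YoungDiagram.mem_iff_lt_colLen (μ := rect h w)).2 (not_le.1 hlt))).1
  omega

theorem mem_rotCompl {h w i j : ℕ} {g : YoungDiagram} :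
    (i, j) ∈ rotCompl h w g ↔ (i < h ∧ j < w) ∧ (h - 1 - i, w - 1 - j) ∉ g := by
  rw [← YoungDiagram.mem_cells]; simp [rotCompl]

theorem colLen_rotCompl_le {h w : ℕ} {g : YoungDiagram} : (rotCompl h w g).colLen 0 ≤ h := by
  by_contra hlt
  have := (mem_rotCompl.1 ((YoungDiagram.mem_iff_lt_colLen (μ := rotCompl h w g)).2
    (not_le.1 hlt))).1.1
  omega

theorem rowLen_le_of_le_rect {h w i : ℕ} {g : YoungDiagram} (hg : g ≤ rect h w) :
    g.rowLen i ≤ w := by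
  by_contra hlt
  have := (mem_rect.1 (hg ((YoungDiagram.mem_iff_lt_rowLen (μ := g)).2 (not_le.1 hlt)))).2
  omega

theorem colLen_le_of_le_rect {h w : ℕ} {g : YoungDiagram} (hg : g ≤ rect h w) :
    g.colLen 0 ≤ h := by
  by_contra hlt
  have := (mem_rect.1 (hg ((YoungDiagram.mem_iff_lt_colLen (μ := g)).2 (not_le.1 hlt)))).1
  omega

theorem rowLen_add_rowLen_rotCompl {h w i : ℕ} {g : YoungDiagram} (hg : g ≤ rect h w)
    (hi : i < h) : g.rowLen i + (rotCompl h w g).rowLen (h - 1 - i) = w := by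
  have key : ∀ j, j < (rotCompl h w g).rowLen (h - 1 - i) ↔ j < w ∧ g.rowLen i ≤ w - 1 - j :=
    fun j => by
      rw [← YoungDiagram.mem_iff_lt_rowLen, mem_rotCompl, YoungDiagram.mem_iff_lt_rowLen,
        show h - 1 - (h - 1 - i) = i by omega, not_lt]
      exact and_congr_left fun _ => and_iff_right (by omega)
  have hle := rowLen_le_of_le_rect (i := i) hg
  -- Testing the columns on both sides of the expected length `w - g.rowLen i` pins it down.
  have h1 := key (w - g.rowLen i)
  have h2 := key ((rotCompl h w g).rowLen (h - 1 - i))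
  have h3 := key (w - g.rowLen i - 1)
  omega

/-! ### Jacobi-Trudi determinants of any sufficiently large size -/

theorem completeH_zero : completeH 0 = 1 := rfl

theorem completeH_of_neg {k : ℤ} (hk : k < 0) : completeH k = 0 := by
  obtain ⟨m, rfl⟩ := Int.eq_negSucc_of_lt_zero hk
  rfl

/-- The determinant `det (h_{l_i + j - i})` of size `n`. -/
noncomputable def jacobiTrudi (n : ℕ) (l : YoungDiagram) : MvPolynomial ℕ ℤ :=
  Matrix.det (Matrix.of fun i j : Fin n => completeH ((l.rowLen i : ℤ) + (j : ℤ) - (i : ℤ)))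

/-- Beyond the length of `l` the last row is `(0, …, 0, 1)`. So partitions of different lengths can
be treated with determinants of one common size. -/
theorem jacobiTrudi_succ {l : YoungDiagram} {n : ℕ} (hl : l.colLen 0 ≤ n) :
    jacobiTrudi (n + 1) l = jacobiTrudi n l := by
  rw [jacobiTrudi, Matrix.det_succ_row _ (Fin.last n),
    Finset.sum_eq_single (Fin.last n) _ (by simp)]
  · have hz : completeH ((l.rowLen n : ℤ) + n - n) = 1 := by
      rw [rowLen_eq_zero hl]; simp [completeH_zero]
    simp only [Matrix.of_apply, Fin.val_last, hz, jacobiTrudi, Fin.succAbove_last, ← two_mul,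
      pow_mul, mul_one]
    simp
    rfl
  · intro j _ hj
    have hlt : (j : ℕ) < n := by
      have := Fin.val_lt_last hj
      simpa using this
    rw [Matrix.of_apply, Fin.val_last, rowLen_eq_zero hl, completeH_of_neg]
    · simp
    · push_cast; omega

theorem schur_eq_jacobiTrudi {l : YoungDiagram} {n : ℕ} (hl : l.colLen 0 ≤ n) :
    schur l = jacobiTrudi n l := by
  induction n, hl using Nat.le_induction with
  | base => rfl
  | succ n hn ih => rw [ih, jacobiTrudi_succ hn]

theorem schur_bot : schur ⊥ = 1 := by
  rw [schur_eq_jacobiTrudi (n := 0) (by simp), jacobiTrudi, Matrix.det_isEmpty]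

/-! ### Specialization to finitely many variables -/

section Specialization

variable {R : Type*} [CommRing R]

theorem geom_mul_one_sub (x : R) :
    PowerSeries.mk (fun k => x ^ k) * (1 - PowerSeries.C x * PowerSeries.X) = 1 := by
  ext k
  rw [mul_sub, mul_one, ← mul_assoc, map_sub]
  cases k with
  | zero => simp
  | succ k => rw [PowerSeries.coeff_succ_mul_X, mul_comm, PowerSeries.coeff_C_mul]; simp [pow_succ']

theorem coeff_prod_one_sub_eq_zero {ι : Type*} (s : Finset ι) (x : ι → R) {k : ℕ}
    (hk : s.card < k) :
    PowerSeries.coeff k (∏ i ∈ s, (1 - PowerSeries.C (x i) * PowerSeries.X)) = 0 := by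
  classical
  induction s using Finset.induction_on generalizing k with
  | empty =>
    have : k ≠ 0 := by simp at hk; omega
    simp [PowerSeries.coeff_one, this]
  | insert a s ha ih =>
    rw [Finset.card_insert_of_notMem ha] at hk
    obtain ⟨k, rfl⟩ : ∃ m, k = m + 1 := ⟨k - 1, by omega⟩
    rw [Finset.prod_insert ha, sub_mul, one_mul, map_sub, ih (by omega), mul_assoc, mul_comm
      PowerSeries.X, ← mul_assoc, PowerSeries.coeff_succ_mul_X, PowerSeries.coeff_C_mul,
      ih (by omega)]
    simp

theorem prod_geom_mul_prod_one_sub {ι : Type*} (s : Finset ι) (x : ι → R) :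
    (∏ i ∈ s, PowerSeries.mk (fun k => x i ^ k)) *
      ∏ i ∈ s, (1 - PowerSeries.C (x i) * PowerSeries.X) = 1 := by
  rw [← Finset.prod_mul_distrib]
  exact Finset.prod_eq_one fun i _ => geom_mul_one_sub (x i)

/-- The product of power series as a finite sum, when the second factor has degree `< n` and the
coefficients of the first one are extended by zero to negative indices. -/
theorem sum_shift_mul_coeff {F : ℤ → R} {H D : PowerSeries R} {n : ℕ}
    (hF : ∀ k : ℕ, F k = PowerSeries.coeff k H) (hneg : ∀ k < 0, F k = 0)
    (hD : ∀ k, n ≤ k → PowerSeries.coeff k D = 0) (a : ℕ) :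
    ∑ j : Fin n, F ((a : ℤ) + j - (n - 1 : ℕ)) * PowerSeries.coeff (n - 1 - j) D =
      PowerSeries.coeff a (H * D) := by
  rw [Fin.sum_univ_eq_sum_range
    (fun j => F ((a : ℤ) + j - (n - 1 : ℕ)) * PowerSeries.coeff (n - 1 - j) D),
    ← Finset.sum_range_reflect, mul_comm H D, PowerSeries.coeff_mul,
    Finset.Nat.sum_antidiagonal_eq_sum_range_succ
      (fun p q => PowerSeries.coeff p D * PowerSeries.coeff q H)]
  have h1 : ∀ m, n ≤ m → ∑ q ∈ Finset.range n, F ((a : ℤ) - q) * PowerSeries.coeff q D =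
      ∑ q ∈ Finset.range m, F ((a : ℤ) - q) * PowerSeries.coeff q D := fun m hm =>
    Finset.sum_subset (Finset.range_mono hm) fun q _ hq => by
      rw [hD q (by simpa using hq), mul_zero]
  have h2 : ∀ m, a + 1 ≤ m → ∑ q ∈ Finset.range (a + 1), F ((a : ℤ) - q) * PowerSeries.coeff q D =
      ∑ q ∈ Finset.range m, F ((a : ℤ) - q) * PowerSeries.coeff q D := fun m hm =>
    Finset.sum_subset (Finset.range_mono hm) fun q _ hq => by
      have : a + 1 ≤ q := by simpa using hq
      rw [hneg _ (by omega), zero_mul]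
  trans ∑ q ∈ Finset.range n, F ((a : ℤ) - q) * PowerSeries.coeff q D
  · refine Finset.sum_congr rfl fun q hq => ?_
    have hq := Finset.mem_range.1 hq
    rw [show (a : ℤ) + (n - 1 - q : ℕ) - (n - 1 : ℕ) = a - q by omega,
      show n - 1 - (n - 1 - q) = q by omega]
  · rw [h1 _ (le_max_left n (a + 1)), ← h2 _ (le_max_right n (a + 1))]
    refine Finset.sum_congr rfl fun q hq => ?_
    have hq := Finset.mem_range.1 hq
    rw [mul_comm, ← hF, Nat.cast_sub (by omega)]

end Specialization

open MvPolynomial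

/-- The generating series of the complete symmetric polynomials in `n` variables. -/
noncomputable def completeSeries (n : ℕ) : PowerSeries (MvPolynomial (Fin n) ℤ) :=
  ∏ i, PowerSeries.mk (fun k => X i ^ k)

/-- The homomorphism sending `h_k` to the complete symmetric polynomial in `n` variables. -/
noncomputable def specialize (n : ℕ) : MvPolynomial ℕ ℤ →ₐ[ℤ] MvPolynomial (Fin n) ℤ :=
  aeval fun k => PowerSeries.coeff (k + 1) (completeSeries n)

theorem specialize_completeH_natCast (n k : ℕ) :
    specialize n (completeH k) = PowerSeries.coeff k (completeSeries n) := by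
  cases k with
  | zero => simp [completeSeries, completeH_zero, PowerSeries.coeff_zero_eq_constantCoeff]
  | succ k =>
    rw [show completeH ((k + 1 : ℕ) : ℤ) = X k from rfl, specialize, aeval_X]

theorem specialize_completeH_of_neg (n : ℕ) {k : ℤ} (hk : k < 0) :
    specialize n (completeH k) = 0 := by rw [completeH_of_neg hk, map_zero]

/-- The antisymmetric determinant `det (x_j ^ (a i))`. -/
noncomputable def alternant {n : ℕ} (a : Fin n → ℕ) : MvPolynomial (Fin n) ℤ :=
  Matrix.det (Matrix.of fun i j => X j ^ a i)

/-- The strictly decreasing sequence `l_i + n - 1 - i`. -/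
def shifted (n : ℕ) (l : YoungDiagram) (i : Fin n) : ℕ := l.rowLen i + (n - 1 - i)

theorem completeSeries_mul_prod_erase {n : ℕ} (l : Fin n) :
    completeSeries n * ∏ i ∈ Finset.univ.erase l, (1 - PowerSeries.C (X i) * PowerSeries.X) =
      PowerSeries.mk (fun k => X l ^ k) := by
  rw [completeSeries, ← Finset.mul_prod_erase _ _ (Finset.mem_univ l), mul_assoc,
    prod_geom_mul_prod_one_sub, mul_one]

/-- Multiplying `∏ 1/(1 - x_i t)` by all factors `1 - x_i t` with `i ≠ k` leaves `1/(1 - x_k t)`.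
Read off coefficientwise, this factors the matrix `(x_k ^ (l_i + n - 1 - i))` as the Jacobi-Trudi
matrix times a matrix independent of `l`. -/
theorem specialize_jacobiTrudi_mul (n : ℕ) (l : YoungDiagram) :
    specialize n (jacobiTrudi n l) *
      Matrix.det (Matrix.of fun j k : Fin n => PowerSeries.coeff (n - 1 - j)
        (∏ i ∈ Finset.univ.erase k,
          (1 - PowerSeries.C (X i : MvPolynomial (Fin n) ℤ) * PowerSeries.X))) =
      alternant (shifted n l) := by
  have hmap := RingHom.map_det (specialize n).toRingHom
    (Matrix.of fun i j : Fin n => completeH ((l.rowLen i : ℤ) + (j : ℤ) - (i : ℤ)))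
  change specialize n (jacobiTrudi n l) = _ at hmap
  rw [hmap, ← Matrix.det_mul, alternant]
  congr 1
  ext1 i k
  rw [Matrix.mul_apply, Matrix.of_apply, ← PowerSeries.coeff_mk (shifted n l i) (fun m => X k ^ m),
    ← completeSeries_mul_prod_erase, ← sum_shift_mul_coeff (n := n)
      (F := fun m => specialize n (completeH m)) (specialize_completeH_natCast n)
      (fun m hm => specialize_completeH_of_neg n hm)]
  · refine Finset.sum_congr rfl fun j _ => ?_
    congr 1
    change specialize n (completeH _) = _
    congr 2
    simp only [shifted]
    have := i.2
    omega
  · intro m hm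
    have := k.2
    exact coeff_prod_one_sub_eq_zero _ _ (by
      rw [Finset.card_erase_of_mem (Finset.mem_univ k), Finset.card_univ, Fintype.card_fin]; omega)

/-- The bialternant formula. -/
theorem specialize_schur_mul_alternant {n : ℕ} {l : YoungDiagram} (hl : l.colLen 0 ≤ n) :
    specialize n (schur l) * alternant (shifted n ⊥) = alternant (shifted n l) := by
  -- The empty partition identifies the auxiliary determinant as the Vandermonde alternant.
  have h0 := specialize_jacobiTrudi_mul n ⊥
  rw [← schur_eq_jacobiTrudi (by simp), schur_bot, map_one, one_mul] at h0
  rw [← h0, schur_eq_jacobiTrudi hl, specialize_jacobiTrudi_mul]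

/-- The coefficients of `∏ (1 - x_i t)`, of degree `n < L`, form a kernel vector of the Jacobi-Trudi
matrix: row `i` produces the coefficient of `t ^ (l_i + L - 1 - i)` in the constant series 1, and
this exponent is positive. -/
theorem specialize_schur_eq_zero {n : ℕ} {l : YoungDiagram} (hl : n < l.colLen 0) :
    specialize n (schur l) = 0 := by
  set L := l.colLen 0 with hL
  have hmap := RingHom.map_det (specialize n).toRingHom
    (Matrix.of fun i j : Fin L => completeH ((l.rowLen i : ℤ) + (j : ℤ) - (i : ℤ)))
  change specialize n (schur l) = _ at hmap
  rw [hmap, ← Matrix.exists_mulVec_eq_zero_iff]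
  set D : PowerSeries (MvPolynomial (Fin n) ℤ) :=
    ∏ i, (1 - PowerSeries.C (X i : MvPolynomial (Fin n) ℤ) * PowerSeries.X) with hDdef
  refine ⟨fun j => PowerSeries.coeff (L - 1 - j) D, fun h0 => ?_, ?_⟩
  -- The last entry is the constant coefficient of `D`, namely 1.
  · have := congrFun h0 ⟨L - 1, by omega⟩
    simp [hDdef] at this
  · ext1 i
    have hpos : 0 < l.rowLen i := rowLen_pos_iff.2 i.2
    rw [Matrix.mulVec, dotProduct, Pi.zero_apply]
    have key := sum_shift_mul_coeff (n := L) (D := D)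
      (F := fun m => specialize n (completeH m)) (specialize_completeH_natCast n)
      (fun m hm => specialize_completeH_of_neg n hm)
      (fun k hk => coeff_prod_one_sub_eq_zero _ _ (by
        rw [Finset.card_univ, Fintype.card_fin]; omega)) (l.rowLen i + (L - 1 - i))
    rw [completeSeries, prod_geom_mul_prod_one_sub, PowerSeries.coeff_one, if_neg (by omega)] at key
    rw [← key]
    refine Finset.sum_congr rfl fun j _ => ?_
    congr 1
    change specialize n (completeH _) = _
    congr 2
    have := i.2
    omega

/-! ### Coefficients of alternants -/

/-- An exponent vector as a finitely supported function. -/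
noncomputable def expo {n : ℕ} (a : Fin n → ℕ) : Fin n →₀ ℕ := Finsupp.equivFunOnFinite.symm a

theorem expo_injective {n : ℕ} : Function.Injective (expo (n := n)) :=
  Finsupp.equivFunOnFinite.symm.injective

theorem prod_X_pow_eq_expo {n : ℕ} (a : Fin n → ℕ) :
    ∏ i, (X i : MvPolynomial (Fin n) ℤ) ^ a i = monomial (expo a) 1 := by
  rw [monomial_eq, Finsupp.prod_fintype _ _ (by simp)]
  simp [expo]

theorem alternant_eq_sum {n : ℕ} (a : Fin n → ℕ) :
    alternant a = ∑ u : Equiv.Perm (Fin n), monomial (expo (a ∘ u)) (Equiv.Perm.sign u : ℤ) := by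
  rw [alternant, Matrix.det_apply]
  refine Finset.sum_congr rfl fun u _ => ?_
  simp only [Matrix.of_apply]
  rw [show ∏ i, (X i : MvPolynomial (Fin n) ℤ) ^ a (u i) = _ from prod_X_pow_eq_expo (a ∘ u),
    Units.smul_def, smul_monomial, smul_eq_mul, mul_one]

theorem shifted_strictAnti {n : ℕ} (l : YoungDiagram) : StrictAnti (shifted n l) := by
  intro i j hij
  have := YoungDiagram.rowLen_anti l i j (le_of_lt hij)
  have hlt : (i : ℕ) < j := hij
  have := j.2
  simp only [shifted]
  omega

theorem shifted_injOn {n : ℕ} {a b : YoungDiagram} (ha : a.colLen 0 ≤ n) (hb : b.colLen 0 ≤ n)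
    (hab : shifted n a = shifted n b) : a = b :=
  ext_rowLen_of_le ha hb fun i hi => by
    have := congrFun hab ⟨i, hi⟩
    simp only [shifted] at this
    omega

theorem perm_eq_one_of_strictMono {n : ℕ} {u : Equiv.Perm (Fin n)} (hu : StrictMono u) : u = 1 := by
  have h1 : (⟨u, fun {a b} => hu.le_iff_le⟩ : Fin n ≃o Fin n) = OrderIso.refl _ :=
    Subsingleton.elim _ _
  ext i
  have := congrArg (fun f : Fin n ≃o Fin n => (f i : ℕ)) h1
  simpa using this

theorem perm_eq_one_of_strictAnti_comp {n : ℕ} {a : Fin n → ℕ} (ha : StrictAnti a)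
    {u : Equiv.Perm (Fin n)} (hu : StrictAnti (a ∘ u)) : u = 1 :=
  perm_eq_one_of_strictMono fun _ _ hij => ha.lt_iff_gt.1 (hu hij)

/-- Among the rearrangements of `a`, only `a` itself is strictly decreasing. -/
theorem coeff_alternant {n : ℕ} {a b : Fin n → ℕ} (ha : StrictAnti a) (hb : StrictAnti b) :
    coeff (expo b) (alternant a) = if a = b then 1 else 0 := by
  rw [alternant_eq_sum, coeff_sum, Finset.sum_eq_single 1]
  · simp [coeff_monomial, expo_injective.eq_iff]
  · intro u _ hu
    rw [coeff_monomial, if_neg]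
    intro he
    have he := expo_injective he
    exact hu (perm_eq_one_of_strictAnti_comp ha (he ▸ hb))
  · simp

theorem alternant_ne_zero {n : ℕ} {a : Fin n → ℕ} (ha : StrictAnti a) : alternant a ≠ 0 := by
  intro h0
  have := coeff_alternant ha ha
  simp [h0] at this

theorem isHomogeneous_alternant {n : ℕ} (a : Fin n → ℕ) :
    (alternant a).IsHomogeneous (∑ i, a i) := by
  rw [alternant_eq_sum]
  refine IsHomogeneous.sum _ _ _ fun u _ => isHomogeneous_monomial _ ?_
  rw [Finsupp.degree_eq_sum]
  exact Equiv.sum_comp u a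

theorem sum_shifted {n : ℕ} {l : YoungDiagram} (hl : l.colLen 0 ≤ n) :
    ∑ i, shifted n l i = l.card + ∑ i, shifted n ⊥ i := by
  rw [card_eq_sum_rowLen hl, ← Finset.sum_add_distrib]
  exact Finset.sum_congr rfl fun i _ => by simp [shifted]

/-- The rearrangement `b ∘ (v * u⁻¹)` equals `N - a`, which is increasing; reversed, it is a
strictly decreasing rearrangement of `b`, hence `b` itself. -/
theorem add_comp_rev_of_add_comp {n N : ℕ} {a b : Fin n → ℕ} (ha : StrictAnti a)
    (hb : StrictAnti b) {u v : Equiv.Perm (Fin n)} (huv : ∀ i, a (u i) + b (v i) = N) :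
    v = Fin.revPerm * u := by
  have key : ∀ j, a j + b ((v * u⁻¹) j) = N := fun j => by simpa using huv (u⁻¹ j)
  have hmono : StrictAnti (b ∘ (v * u⁻¹ * Fin.revPerm : Equiv.Perm (Fin n))) := by
    intro i j hij
    have h1 := key (Fin.rev i)
    have h2 := key (Fin.rev j)
    have h3 := ha (Fin.rev_lt_rev.2 hij)
    simp at h1 h2 ⊢
    omega
  have := perm_eq_one_of_strictAnti_comp hb hmono
  have hrev : (Fin.revPerm : Equiv.Perm (Fin n)) * Fin.revPerm = 1 := by ext; simp
  calc v = (v * u⁻¹ * Fin.revPerm) * (Fin.revPerm * u) := by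
        rw [mul_assoc (v * u⁻¹), ← mul_assoc Fin.revPerm, hrev]; group
    _ = Fin.revPerm * u := by rw [this, one_mul]

/-- For each of the `n!` permutations `u`, only `v = rev * u` can contribute, and its sign times
that of `u` is the sign of the reversal. -/
theorem coeff_const_alternant_mul {n N : ℕ} {a b : Fin n → ℕ} (ha : StrictAnti a)
    (hb : StrictAnti b) :
    coeff (expo fun _ => N) (alternant a * alternant b) =
      if ∀ i, a i + b (Fin.rev i) = N then
        (n.factorial : ℤ) * Equiv.Perm.sign (Fin.revPerm : Equiv.Perm (Fin n)) else 0 := by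
  have hterm : ∀ u v : Equiv.Perm (Fin n),
      expo (a ∘ u) + expo (b ∘ v) = expo (fun _ => N) ↔ ∀ i, a (u i) + b (v i) = N := fun u v => by
    rw [DFunLike.ext_iff]; simp [expo]
  rw [alternant_eq_sum, alternant_eq_sum, Finset.sum_mul_sum, coeff_sum]
  simp only [coeff_sum, monomial_mul, coeff_monomial, hterm]
  have hinner : ∀ u : Equiv.Perm (Fin n), ∑ v : Equiv.Perm (Fin n),
      (if ∀ i, a (u i) + b (v i) = N then
        (Equiv.Perm.sign u : ℤ) * (Equiv.Perm.sign v : ℤ) else 0) =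
      if ∀ i, a i + b (Fin.rev i) = N then
        ((Equiv.Perm.sign (Fin.revPerm : Equiv.Perm (Fin n)) : ℤˣ) : ℤ) else 0 := fun u => by
    rw [Finset.sum_eq_single (Fin.revPerm * u)]
    · have hiff : (∀ i, a (u i) + b ((Fin.revPerm * u : Equiv.Perm (Fin n)) i) = N) ↔
          ∀ i, a i + b (Fin.rev i) = N := by
        rw [← u.forall_congr_right (q := fun i => a i + b (Fin.rev i) = N)]
        rfl
      rw [if_congr hiff rfl rfl]
      congr 1
      rw [Equiv.Perm.sign_mul, ← Units.val_mul, mul_left_comm, Int.units_mul_self, mul_one]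
    · intro v _ hv
      exact if_neg fun h => hv (add_comp_rev_of_add_comp ha hb h)
    · simp
  rw [Finset.sum_congr rfl fun u _ => hinner u, Finset.sum_const, Finset.card_univ,
    Fintype.card_perm, Fintype.card_fin]
  split_ifs <;> simp

/-! ### The Schur functions span the ring of symmetric functions -/

theorem exists_rowLen_eq {n : ℕ} {b : Fin n → ℕ} (hb : Antitone b) :
    ∃ l : YoungDiagram, l.colLen 0 ≤ n ∧ ∀ i : Fin n, l.rowLen i = b i := by
  refine ⟨YoungDiagram.ofRowLens (List.ofFn b) (List.sortedGE_ofFn_iff.2 hb), ?_, fun i => ?_⟩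
  · by_contra hlt
    obtain ⟨hn, _⟩ := YoungDiagram.mem_ofRowLens.1 (YoungDiagram.mem_iff_lt_colLen.2 (not_le.1 hlt))
    simp at hn
  · have := YoungDiagram.rowLen_ofRowLens (w := List.ofFn b) (hw := List.sortedGE_ofFn_iff.2 hb)
      (Fin.cast (List.length_ofFn).symm i)
    simpa using this

/-- Expanding the square, the cross term is nonnegative by the rearrangement inequality and `∑ (u i
- i)^2` is positive. -/
theorem sum_sq_lt_of_perm {n : ℕ} {b : Fin n → ℤ} (hb : Antitone b) {u : Equiv.Perm (Fin n)}
    (hu : u ≠ 1) : ∑ i, b i ^ 2 < ∑ i, (b i + (u i : ℕ) - (i : ℕ)) ^ 2 := by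
  have h1 : ∑ i, b i * ((i : ℕ) : ℤ) ≤ ∑ i, b i * ((u i : ℕ) : ℤ) := by
    refine Antivary.sum_mul_le_sum_mul_comp_perm (f := b) (g := fun i => ((i : ℕ) : ℤ)) ?_
    intro i j hij
    exact hb (le_of_lt (by simpa using hij))
  have h2 : 0 < ∑ i, (((u i : ℕ) : ℤ) - (i : ℕ)) ^ 2 := by
    obtain ⟨i, hi⟩ : ∃ i, u i ≠ i := by
      by_contra! hall
      exact hu (Equiv.ext hall)
    refine Finset.sum_pos' (fun _ _ => sq_nonneg _) ⟨i, Finset.mem_univ i, ?_⟩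
    have : ((u i : ℕ) : ℤ) - (i : ℕ) ≠ 0 := fun h0 => hi (Fin.ext (by omega))
    positivity
  have h3 : ∑ i, (b i + (u i : ℕ) - (i : ℕ)) ^ 2 = ∑ i, b i ^ 2 +
      2 * (∑ i, b i * ((u i : ℕ) : ℤ) - ∑ i, b i * ((i : ℕ) : ℤ)) +
      ∑ i, (((u i : ℕ) : ℤ) - (i : ℕ)) ^ 2 := by
    rw [← Finset.sum_sub_distrib, Finset.mul_sum, ← Finset.sum_add_distrib,
      ← Finset.sum_add_distrib]
    exact Finset.sum_congr rfl fun i _ => by ring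
  linarith

/-- In the Jacobi-Trudi expansion the identity permutation gives `∏ h_{b_i}`; every other nonzero
term has the same index sum `s` but a larger sum of squares. Since that sum is at most `s ^ 2`,
induction on the gap, bounded by `m`, terminates. -/
theorem prod_completeH_mem_span_of_lt (n s m : ℕ) :
    ∀ b : Fin n → ℕ, ∑ i, b i = s → s ^ 2 - ∑ i, b i ^ 2 < m →
      ∏ i, completeH (b i) ∈ Submodule.span ℤ (Set.range schur) := by
  induction m with
  | zero => intro b _ h0; omega
  | succ m ih =>
    suffices hanti : ∀ b : Fin n → ℕ, Antitone b → ∑ i, b i = s → s ^ 2 - ∑ i, b i ^ 2 < m + 1 →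
        ∏ i, completeH (b i) ∈ Submodule.span ℤ (Set.range schur) by
      intro b hs hm
      set p : Equiv.Perm (Fin n) := Fin.revPerm.trans (Tuple.sort b) with hp
      have := hanti (b ∘ p) (fun i j hij =>
        Tuple.monotone_sort b (Fin.rev_le_rev.2 hij)) (by
          rw [← hs]; exact Equiv.sum_comp p b) (by
          rwa [show ∑ i, (b ∘ p) i ^ 2 = ∑ i, b i ^ 2 from Equiv.sum_comp p (fun i => b i ^ 2)])
      rwa [show ∏ i, completeH ((b ∘ p) i) = ∏ i, completeH (b i) from
        Equiv.prod_comp p (fun i => completeH (b i))] at this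
    intro b hb hs hm
    obtain ⟨l, hl, hrow⟩ := exists_rowLen_eq hb
    have hexp : schur l = ∑ u : Equiv.Perm (Fin n), Equiv.Perm.sign u •
        ∏ i : Fin n, completeH ((b i : ℤ) + (u i : ℕ) - (i : ℕ)) := by
      rw [schur_eq_jacobiTrudi hl, jacobiTrudi, ← Matrix.det_transpose, Matrix.det_apply]
      simp only [Matrix.transpose_apply, Matrix.of_apply, hrow]
    rw [← Finset.add_sum_erase _ _ (Finset.mem_univ 1)] at hexp
    have hone : ∏ i : Fin n, completeH (b i) = schur l -
        ∑ u ∈ Finset.univ.erase (1 : Equiv.Perm (Fin n)), Equiv.Perm.sign u •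
          ∏ i : Fin n, completeH ((b i : ℤ) + (u i : ℕ) - (i : ℕ)) := by
      rw [hexp]; simp
    rw [hone]
    refine sub_mem (Submodule.subset_span ⟨l, rfl⟩) (sum_mem fun u hu => ?_)
    have hu := Finset.ne_of_mem_erase hu
    rw [Units.smul_def]
    refine Submodule.smul_mem _ _ ?_
    by_cases hneg : ∃ i : Fin n, (b i : ℤ) + (u i : ℕ) - (i : ℕ) < 0
    · obtain ⟨i, hi⟩ := hneg
      rw [Finset.prod_eq_zero (Finset.mem_univ i) (completeH_of_neg hi)]
      exact zero_mem _
    · push Not at hneg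
      choose c hc using fun i => Int.eq_ofNat_of_zero_le (hneg i)
      have hsum : ∑ i, c i = s := by
        zify
        rw [← Finset.sum_congr rfl fun i _ => hc i, Finset.sum_sub_distrib,
          Finset.sum_add_distrib, Equiv.sum_comp u (fun i : Fin n => ((i : ℕ) : ℤ)), ← hs]
        simp
      have hsq : ∑ i, b i ^ 2 < ∑ i, c i ^ 2 := by
        have := sum_sq_lt_of_perm (b := fun i => (b i : ℤ))
          (fun i j hij => Nat.cast_le.2 (hb hij)) hu
        zify
        rwa [Finset.sum_congr rfl fun i _ => congrArg (· ^ 2) (hc i)] at this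
      -- This keeps the natural subtraction from truncating, so the gap strictly drops.
      have hle : ∑ i, c i ^ 2 ≤ s ^ 2 := by
        rw [← hsum]
        exact Finset.sum_sq_le_sq_sum_of_nonneg fun _ _ => Nat.zero_le _
      rw [Finset.prod_congr rfl fun i _ => congrArg completeH (hc i)]
      exact ih c hsum (by omega)

theorem exists_prod_completeH (d : ℕ →₀ ℕ) :
    ∃ (n : ℕ) (b : Fin n → ℕ), monomial d (1 : ℤ) = ∏ i, completeH (b i) := by
  induction d using Finsupp.induction_linear with
  | zero => exact ⟨0, ![], by simp⟩
  | add f g hf hg =>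
    obtain ⟨n, b, hb⟩ := hf
    obtain ⟨m, c, hc⟩ := hg
    refine ⟨n + m, Fin.append b c, ?_⟩
    rw [Fin.prod_univ_add]
    simp [← hb, ← hc, monomial_mul]
  | single k e =>
    refine ⟨e, fun _ => k + 1, ?_⟩
    rw [Finset.prod_const, Finset.card_univ, Fintype.card_fin,
      show completeH ((k + 1 : ℕ) : ℤ) = X k from rfl, X_pow_eq_monomial]

theorem span_schur_eq_top : Submodule.span ℤ (Set.range schur) = ⊤ := by
  rw [eq_top_iff]
  rintro p -
  rw [p.as_sum]
  refine sum_mem fun d _ => ?_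
  obtain ⟨n, b, hb⟩ := exists_prod_completeH d
  rw [show monomial d (coeff d p) = coeff d p • monomial d (1 : ℤ) by simp [smul_monomial], hb]
  exact Submodule.smul_mem _ _ (prod_completeH_mem_span_of_lt n _ _ b rfl (Nat.lt_succ_self _))

theorem exists_eq_sum_schur (p : MvPolynomial ℕ ℤ) :
    ∃ c : YoungDiagram →₀ ℤ, p = c.sum fun l z => z • schur l := by
  have hp : p ∈ Submodule.span ℤ (Set.range schur) := span_schur_eq_top ▸ Submodule.mem_top
  obtain ⟨c, hc⟩ := (Finsupp.mem_span_range_iff_exists_finsupp).1 hp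
  exact ⟨c, hc.symm⟩

/-! ### Littlewood-Richardson coefficients as coefficients of polynomials -/

theorem specialize_sum_schur_mul (n : ℕ) (c : YoungDiagram →₀ ℤ) :
    specialize n (c.sum fun l z => z • schur l) * alternant (shifted n ⊥) =
      ∑ l ∈ c.support, if l.colLen 0 ≤ n then c l • alternant (shifted n l) else 0 := by
  rw [Finsupp.sum, map_sum, Finset.sum_mul]
  refine Finset.sum_congr rfl fun l _ => ?_
  rw [map_zsmul, smul_mul_assoc]
  split_ifs with hl
  · rw [specialize_schur_mul_alternant hl]
  · rw [specialize_schur_eq_zero (not_le.1 hl), zero_mul, smul_zero]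

/-- This replaces linear independence: partitions longer than `n` vanish, and the remaining
alternants have distinct leading exponents. -/
theorem coeff_specialize_sum_schur {n : ℕ} {g : YoungDiagram} (hg : g.colLen 0 ≤ n)
    (c : YoungDiagram →₀ ℤ) :
    coeff (expo (shifted n g))
      (specialize n (c.sum fun l z => z • schur l) * alternant (shifted n ⊥)) = c g := by
  rw [specialize_sum_schur_mul, coeff_sum, Finset.sum_eq_single g]
  · rw [if_pos hg, coeff_smul, coeff_alternant (shifted_strictAnti g) (shifted_strictAnti g)]
    simp
  · intro l _ hl
    split_ifs with hln
    · rw [coeff_smul, coeff_alternant (shifted_strictAnti l) (shifted_strictAnti g), if_neg,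
        smul_zero]
      exact fun he => hl (shifted_injOn hln hg he)
    · simp
  · intro hgc
    rw [Finsupp.notMem_support_iff.1 hgc]
    simp

/-- Spanning excludes the default value in `lrCoeff`, and a single chosen expansion serves all `g`.
-/
theorem exists_lrCoeff (a b : YoungDiagram) :
    ∃ c : YoungDiagram →₀ ℤ, schur a * schur b = c.sum (fun l z => z • schur l) ∧
      ∀ g, lrCoeff g a b = c g := by
  have hex := exists_eq_sum_schur (schur a * schur b)
  exact ⟨hex.choose, hex.choose_spec, fun g => by rw [lrCoeff, dif_pos hex]⟩

theorem lrCoeff_eq_coeff {n : ℕ} {g : YoungDiagram} (hg : g.colLen 0 ≤ n) (a b : YoungDiagram) :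
    lrCoeff g a b = coeff (expo (shifted n g))
      (specialize n (schur a * schur b) * alternant (shifted n ⊥)) := by
  obtain ⟨c, hc, hlr⟩ := exists_lrCoeff a b
  rw [hlr, hc, coeff_specialize_sum_schur hg]

/-- In `g.colLen 0` variables the coefficient is still visible, but `schur a` already vanishes. -/
theorem lrCoeff_eq_zero_of_colLen_lt {g a : YoungDiagram} (ha : g.colLen 0 < a.colLen 0)
    (b : YoungDiagram) : lrCoeff g a b = 0 := by
  rw [lrCoeff_eq_coeff le_rfl, map_mul, specialize_schur_eq_zero ha]
  simp

open Classical in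
theorem lrCoeff_bot (g b : YoungDiagram) : lrCoeff g ⊥ b = if b = g then 1 else 0 := by
  set n := max (g.colLen 0) (b.colLen 0)
  have hg : g.colLen 0 ≤ n := le_max_left _ _
  have hb : b.colLen 0 ≤ n := le_max_right _ _
  rw [lrCoeff_eq_coeff hg, schur_bot, one_mul, specialize_schur_mul_alternant hb,
    coeff_alternant (shifted_strictAnti b) (shifted_strictAnti g)]
  exact if_congr ⟨shifted_injOn hb hg, fun h => h ▸ rfl⟩ rfl rfl

theorem alternant_mul_alternant {n : ℕ} {a b : YoungDiagram} (ha : a.colLen 0 ≤ n)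
    (hb : b.colLen 0 ≤ n) :
    alternant (shifted n a) * alternant (shifted n b) =
      (specialize n (schur a * schur b) * alternant (shifted n ⊥)) * alternant (shifted n ⊥) := by
  rw [← specialize_schur_mul_alternant ha, ← specialize_schur_mul_alternant hb, map_mul]
  ring

theorem isHomogeneous_of_mul {σ R : Type*} [CommRing R] [IsDomain R] {p q : MvPolynomial σ R}
    {m e : ℕ} (hpq : (p * q).IsHomogeneous (m + e)) (hq : q.IsHomogeneous e) (hq0 : q ≠ 0) :
    p.IsHomogeneous m := by
  have hcomp : ∀ d, homogeneousComponent (d + e) (p * q) = homogeneousComponent d p * q := by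
    intro d
    conv_lhs => rw [← sum_homogeneousComponent p, Finset.sum_mul, map_sum]
    rw [Finset.sum_congr rfl fun i _ => homogeneousComponent_of_mem
      ((homogeneousComponent_isHomogeneous i p).mul hq)]
    simp only [add_left_inj, Finset.sum_ite_eq, Finset.mem_range]
    split_ifs with hd
    · rfl
    · rw [homogeneousComponent_eq_zero _ _ (by omega), zero_mul]
  have hzero : ∀ d, d ≠ m → homogeneousComponent d p = 0 := fun d hd => by
    have := hcomp d
    rw [homogeneousComponent_of_mem hpq, if_neg (by omega)] at this
    exact (mul_eq_zero.1 this.symm).resolve_right hq0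
  rw [← sum_homogeneousComponent p]
  refine IsHomogeneous.sum _ _ _ fun i _ => ?_
  rcases eq_or_ne i m with rfl | hi
  · exact homogeneousComponent_isHomogeneous i p
  · rw [hzero i hi]
    exact isHomogeneous_zero _ _ _

/-- Alternants are homogeneous; cancelling a Vandermonde factor leaves a homogeneous polynomial
whose degree must match that of the exponent of `g`. -/
theorem card_eq_of_lrCoeff_ne_zero {g a b : YoungDiagram} (h0 : lrCoeff g a b ≠ 0) :
    a.card + b.card = g.card := by
  by_contra hne
  apply h0
  set n := max (g.colLen 0) (max (a.colLen 0) (b.colLen 0))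
  have hg : g.colLen 0 ≤ n := le_max_left _ _
  have ha : a.colLen 0 ≤ n := (le_max_left _ _).trans (le_max_right _ _)
  have hb : b.colLen 0 ≤ n := (le_max_right _ _).trans (le_max_right _ _)
  set δ := ∑ i, shifted n ⊥ i with hδ
  set F := specialize n (schur a * schur b) * alternant (shifted n ⊥) with hF
  have hhom : (F * alternant (shifted n ⊥)).IsHomogeneous ((a.card + b.card + δ) + δ) := by
    have := (isHomogeneous_alternant (shifted n a)).mul (isHomogeneous_alternant (shifted n b))
    rw [sum_shifted ha, sum_shifted hb, alternant_mul_alternant ha hb] at this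
    convert this using 1
    ring
  have hFh : F.IsHomogeneous (a.card + b.card + δ) :=
    isHomogeneous_of_mul hhom (isHomogeneous_alternant _) (alternant_ne_zero (shifted_strictAnti _))
  rw [lrCoeff_eq_coeff hg, ← hF]
  refine hFh.coeff_eq_zero ?_
  rw [Finsupp.degree_eq_sum]
  have := sum_shifted hg
  simp only [expo, Finsupp.equivFunOnFinite_symm_apply_apply]
  omega

/-- Expand `alternant a * alternant b` as `∑ c_l * alternant l * alternant ⊥` and compare
coefficients of `(x_1 ⋯ x_h) ^ (w + h - 1)`. Only the rectangle is complementary to `⊥`, so only its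
term survives, and the common factor `± h!` cancels. -/
theorem lrCoeff_rect {h w : ℕ} {a b : YoungDiagram} (ha : a.colLen 0 ≤ h) (hb : b.colLen 0 ≤ h) :
    lrCoeff (rect h w) a b =
      if ∀ i : Fin h, a.rowLen i + b.rowLen (h - 1 - i) = w then 1 else 0 := by
  have hkey : ∀ {c d : YoungDiagram}, coeff (expo fun _ => w + (h - 1))
      (alternant (shifted h c) * alternant (shifted h d)) =
      if ∀ i : Fin h, c.rowLen i + d.rowLen (h - 1 - i) = w then
        (h.factorial : ℤ) * Equiv.Perm.sign (Fin.revPerm : Equiv.Perm (Fin h)) else 0 := by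
    intro c d
    rw [coeff_const_alternant_mul (shifted_strictAnti c) (shifted_strictAnti d)]
    refine if_congr (forall_congr' fun i => ?_) rfl rfl
    have := i.2
    simp only [shifted, Fin.val_rev]
    rw [show h - (i + 1 : ℕ) = h - 1 - i by omega]
    omega
  obtain ⟨c, hc, hlr⟩ := exists_lrCoeff a b
  have hmul := alternant_mul_alternant ha hb
  rw [hc, specialize_sum_schur_mul, Finset.sum_mul] at hmul
  have hco := congrArg (coeff (expo fun _ => w + (h - 1))) hmul
  have hne : (h.factorial : ℤ) * Equiv.Perm.sign (Fin.revPerm : Equiv.Perm (Fin h)) ≠ 0 :=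
    mul_ne_zero (by exact_mod_cast h.factorial_ne_zero) (Units.ne_zero _)
  have hrect : ∀ i : Fin h,
      (rect h w).rowLen i + (⊥ : YoungDiagram).rowLen (h - 1 - i) = w := fun i => by
    rw [rowLen_rect i.2, rowLen_bot, add_zero]
  rw [hkey, coeff_sum, Finset.sum_eq_single (rect h w)] at hco
  · rw [if_pos colLen_rect_le, smul_mul_assoc, coeff_smul, hkey,
      if_pos hrect, smul_eq_mul] at hco
    rw [hlr]
    split_ifs at hco ⊢ with hcond
    · exact mul_right_cancel₀ hne (by rw [← hco, one_mul])
    · exact (mul_eq_zero.1 hco.symm).resolve_right hne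
  · intro l _ hl
    split_ifs with hlh
    · rw [smul_mul_assoc, coeff_smul, hkey, if_neg, smul_zero]
      exact fun hall => hl (ext_rowLen_of_le hlh colLen_rect_le fun i hi => by
        have := hall ⟨i, hi⟩
        rw [rowLen_bot, add_zero] at this
        rw [rowLen_rect hi, this])
    · simp
  · intro hR
    rw [Finsupp.notMem_support_iff.1 hR]
    simp

/-! ### Straightening of weakly decreasing sequences -/

theorem StraightensIn.eq_of_sortedGE {I J : List ℕ} {m : ℕ} (hm : StraightensIn I m J)
    (hI : I.Pairwise (· ≥ ·)) : m = 0 ∧ J = I := by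
  cases hm with
  | refl => exact ⟨rfl, rfl⟩
  | move u v J a b m hab hJ =>
    have h1 := (List.pairwise_append.1 hI).2.1
    have h2 := (List.pairwise_cons.1 h1).1 b (by simp)
    omega

theorem rowLen_eq_getD_rowLens (l : YoungDiagram) (k i : ℕ) :
    l.rowLen i = (l.rowLens ++ List.replicate k 0).getD i 0 := by
  rcases lt_or_ge i (l.colLen 0) with hi | hi
  · rw [List.getD_append _ _ _ _ (by rwa [YoungDiagram.length_rowLens]),
      List.getD_eq_getElem _ _ (by rwa [YoungDiagram.length_rowLens]), YoungDiagram.get_rowLens]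
  · rw [rowLen_eq_zero hi, List.getD_append_right _ _ _ _ (by rwa [YoungDiagram.length_rowLens])]
    rw [List.getD_eq_getElem?_getD, List.getElem?_replicate]
    split_ifs <;> rfl

theorem eq_of_rowLens_append_replicate {a b : YoungDiagram} {j k : ℕ}
    (hab : a.rowLens ++ List.replicate j 0 = b.rowLens ++ List.replicate k 0) : a = b :=
  ext_rowLen fun i => by rw [rowLen_eq_getD_rowLens a j, rowLen_eq_getD_rowLens b k, hab]

theorem pairwise_rowLens_append_replicate (l : YoungDiagram) (k : ℕ) :
    (l.rowLens ++ List.replicate k 0).Pairwise (· ≥ ·) := by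
  rw [List.pairwise_append]
  refine ⟨l.rowLens_sorted.pairwise, by simp [List.pairwise_replicate], ?_⟩
  intro a _ b hb
  rw [List.eq_of_mem_replicate hb]
  exact Nat.zero_le _

open Classical in
theorem straightenCoeff_rowLens (a l : YoungDiagram) (k : ℕ) :
    straightenCoeff (a.rowLens ++ List.replicate k 0) l = if a = l then 1 else 0 := by
  have hpw := pairwise_rowLens_append_replicate a k
  rw [straightenCoeff]
  split_ifs with hex hal hal
  · obtain ⟨j, hj⟩ := hex.choose_spec
    rw [(hj.eq_of_sortedGE hpw).1, pow_zero]
  · obtain ⟨j, hj⟩ := hex.choose_spec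
    exact absurd (eq_of_rowLens_append_replicate (hj.eq_of_sortedGE hpw).2).symm hal
  · exact absurd ⟨0, k, hal ▸ StraightensIn.refl _⟩ hex
  · rfl

theorem attachSeq_zero_left (e : ℕ) (s t : YoungDiagram) : attachSeq 0 e s t = t.rowLens := by
  simp [attachSeq]

theorem rowLens_bot : (⊥ : YoungDiagram).rowLens = [] :=
  List.eq_nil_of_length_eq_zero (by rw [YoungDiagram.length_rowLens, colLen_bot])

theorem attachSeq_bot {f : ℕ} {s : YoungDiagram} (hs : s.colLen 0 ≤ f) :
    attachSeq f 0 s ⊥ = s.rowLens ++ List.replicate (f - s.colLen 0) 0 := by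
  rw [attachSeq, rowLens_bot, List.append_nil]
  refine List.ext_getElem (by simp; omega) fun i h1 h2 => ?_
  rw [← List.getD_eq_getElem _ 0 h2, ← rowLen_eq_getD_rowLens]
  simp

open Classical in
theorem straightenCoeff_attachSeq_bot {f : ℕ} {s : YoungDiagram} (hs : s.colLen 0 ≤ f)
    (l : YoungDiagram) : straightenCoeff (attachSeq f 0 s ⊥) l = if s = l then 1 else 0 := by
  rw [attachSeq_bot hs, straightenCoeff_rowLens]

open Classical in
theorem straightenCoeff_attachSeq_zero_left (e : ℕ) (s t l : YoungDiagram) :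
    straightenCoeff (attachSeq 0 e s t) l = if t = l then 1 else 0 := by
  have := straightenCoeff_rowLens t l 0
  rwa [attachSeq_zero_left, ← List.append_nil t.rowLens]

/-! ### The quiver coefficients -/

theorem finsum_finsum_finsum_eq_single {A B C : Type*} (f : A → B → C → ℤ) (a : A) (b : B) (c : C)
    (hf : ∀ x y z, f x y z ≠ 0 → x = a ∧ y = b ∧ z = c) :
    ∑ᶠ (x : A) (y : B) (z : C), f x y z = f a b c := by
  have h1 : ∀ x y, x ≠ a ∨ y ≠ b → ∑ᶠ z, f x y z = 0 := fun x y hxy =>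
    finsum_eq_zero_of_forall_eq_zero fun z => by
      by_contra hne
      have := hf x y z hne
      tauto
  rw [finsum_eq_single _ a fun x hx => finsum_eq_zero_of_forall_eq_zero fun y => h1 x y (.inl hx),
    finsum_eq_single _ b fun y hy => h1 a y (.inr hy),
    finsum_eq_single _ c fun z hz => by
      by_contra hne
      exact hz (hf a b z hne).2.2]

open Classical in
theorem quiverCoeff_two {r : ℕ → ℕ → ℕ} {h w : ℕ}
    (h01 : rectHeight r 0 1 = h ∧ rectWidth r 0 1 = 0)
    (h12 : rectHeight r 1 2 = 0 ∧ rectWidth r 1 2 = w)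
    (h02 : rectHeight r 0 2 = h ∧ rectWidth r 0 2 = w) (l : Fin 2 → YoungDiagram) :
    quiverCoeff 2 r l =
      if (l 0).colLen 0 ≤ h then lrCoeff (rect h w) (l 0) (l 1) else 0 := by
  have h01' : rectHeight (fun i j => r i (j + 1)) 0 1 = h ∧
      rectWidth (fun i j => r i (j + 1)) 0 1 = w := h02
  have hterm : ∀ mu s t : Fin 1 → YoungDiagram,
      (if ∀ i : Fin 1, (s i).card + (t i).card = (mu i).card ∧
            (s i).colLen 0 ≤ rectHeight r i (i + 1) then
          quiverCoeff 1 (fun i j => r i (j + 1)) mu *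
            (∏ i : Fin 1, lrCoeff (mu i) (s i) (t i)) *
            ∏ k : Fin 2, straightenCoeff
              (attachSeq (rectHeight r k (k + 1)) (rectWidth r k (k + 1))
                ((Fin.snoc s ⊥ : Fin 2 → YoungDiagram) k)
                ((Fin.cons ⊥ t : Fin 2 → YoungDiagram) k)) (l k)
        else 0) =
      if mu 0 = rect h w ∧ s 0 = l 0 ∧ t 0 = l 1 ∧ (s 0).colLen 0 ≤ h then
        lrCoeff (rect h w) (l 0) (l 1) else 0 := by
    intro mu s t
    have hsnoc : (Fin.snoc s ⊥ : Fin 2 → YoungDiagram) 0 = s 0 := rfl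
    have hcons : (Fin.cons ⊥ t : Fin 2 → YoungDiagram) 1 = t 0 := rfl
    simp only [Fin.forall_fin_one, Fin.prod_univ_one, Fin.prod_univ_two, Fin.val_zero, Fin.val_one,
      zero_add, Nat.reduceAdd, h01, h12, Fin.cons_zero, hsnoc, hcons,
      straightenCoeff_attachSeq_zero_left, quiverCoeff, h01']
    by_cases hs : (s 0).colLen 0 ≤ h
    · simp only [straightenCoeff_attachSeq_bot hs, hs, and_true]
      by_cases h1 : mu 0 = rect h w <;> by_cases h2 : s 0 = l 0 <;>
        by_cases h3 : t 0 = l 1 <;> simp only [h1, h2, h3, if_true, if_false, mul_zero,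
          zero_mul, ite_self, true_and, false_and, and_true, one_mul, mul_one]
      -- The size condition is automatic wherever the coefficient is nonzero.
      split_ifs with hc
      · rfl
      · by_contra hne
        exact hc (card_eq_of_lrCoeff_ne_zero (Ne.symm hne))
    · simp only [hs, and_false, if_false]
  rw [quiverCoeff]
  refine (finsum_congr fun mu => finsum_congr fun s => finsum_congr fun t => hterm mu s t).trans ?_
  rw [finsum_finsum_finsum_eq_single _ (fun _ => rect h w) (fun _ => l 0) (fun _ => l 1)]
  · simp
  · intro mu s t hne
    have hc := (ite_ne_right_iff.1 hne).1
    refine ⟨funext fun i => ?_, funext fun i => ?_, funext fun i => ?_⟩ <;>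
      rw [Subsingleton.elim i 0]
    exacts [hc.1, hc.2.1, hc.2.2.1]

/-- Complementation in the rectangle is injective, so the second entry determines the first. -/
theorem RealizesArray.quiverCoeff_shift {h w : ℕ} {r : ℕ → ℕ → ℕ} (hr : RealizesArray h w r)
    {g : YoungDiagram} (hg : g ≤ rect h w) (mu : Fin 2 → YoungDiagram)
    (hmu : mu 1 = rotCompl h w g) :
    quiverCoeff 2 (fun i j => r i (j + 1)) mu = open Classical in if mu 0 = g then 1 else 0 := by
  rw [quiverCoeff_two (h := h) (w := w) hr.R02 hr.R13 hr.R03]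
  split_ifs with h1 h2 h2
  · rw [lrCoeff_rect h1 (hmu ▸ colLen_rotCompl_le), if_pos]
    intro i
    rw [h2, hmu, rowLen_add_rowLen_rotCompl hg i.2]
  · rw [lrCoeff_rect h1 (hmu ▸ colLen_rotCompl_le), if_neg]
    intro hall
    refine h2 (ext_rowLen_of_le h1 (colLen_le_of_le_rect hg) fun i hi => ?_)
    have e1 := hall ⟨i, hi⟩
    have e2 := rowLen_add_rowLen_rotCompl hg hi
    rw [hmu] at e1
    exact Nat.add_right_cancel (e1.trans e2.symm)
  · exact absurd (h2 ▸ colLen_le_of_le_rect hg) h1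
  · rfl

open Classical in
theorem RealizesArray.quiverCoeff_eq {h w : ℕ} {r : ℕ → ℕ → ℕ} (hr : RealizesArray h w r)
    {g : YoungDiagram} (hg : g ≤ rect h w) (a b : YoungDiagram) :
    quiverCoeff 3 r ![a, b, rotCompl h w g] = lrCoeff g a b := by
  have hterm : ∀ mu s t : Fin 2 → YoungDiagram,
      (if ∀ i : Fin 2, (s i).card + (t i).card = (mu i).card ∧
            (s i).colLen 0 ≤ rectHeight r i (i + 1) then
          quiverCoeff 2 (fun i j => r i (j + 1)) mu *
            (∏ i : Fin 2, lrCoeff (mu i) (s i) (t i)) *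
            ∏ k : Fin 3, straightenCoeff
              (attachSeq (rectHeight r k (k + 1)) (rectWidth r k (k + 1))
                ((Fin.snoc s ⊥ : Fin 3 → YoungDiagram) k)
                ((Fin.cons ⊥ t : Fin 3 → YoungDiagram) k)) (![a, b, rotCompl h w g] k)
        else 0) =
      if (mu 0 = g ∧ mu 1 = rotCompl h w g) ∧ (s 0 = a ∧ s 1 = ⊥) ∧
          (t 0 = b ∧ t 1 = rotCompl h w g) then lrCoeff g a b else 0 := by
    intro mu s t
    have hsnoc0 : (Fin.snoc s ⊥ : Fin 3 → YoungDiagram) 0 = s 0 := rfl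
    have hsnoc1 : (Fin.snoc s ⊥ : Fin 3 → YoungDiagram) 1 = s 1 := rfl
    have hsnoc2 : (Fin.snoc s ⊥ : Fin 3 → YoungDiagram) 2 = ⊥ := rfl
    have hcons1 : (Fin.cons ⊥ t : Fin 3 → YoungDiagram) 1 = t 0 := rfl
    have hcons2 : (Fin.cons ⊥ t : Fin 3 → YoungDiagram) 2 = t 1 := rfl
    simp only [Fin.forall_fin_two, Fin.prod_univ_three, Fin.prod_univ_two, Fin.val_zero,
      Fin.val_one, Fin.val_two, zero_add, Nat.reduceAdd, hr.R01, hr.R12, hr.R23, Fin.cons_zero,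
      hsnoc0, hsnoc1, hsnoc2, hcons1, hcons2, straightenCoeff_attachSeq_zero_left,
      Matrix.cons_val_zero, Matrix.cons_val_one, Matrix.cons_val]
    by_cases hP : (mu 0 = g ∧ mu 1 = rotCompl h w g) ∧ (s 0 = a ∧ s 1 = ⊥) ∧
        (t 0 = b ∧ t 1 = rotCompl h w g)
    · rw [if_pos hP]
      obtain ⟨⟨hm0, hm1⟩, ⟨hs0, hs1⟩, ht0, ht1⟩ := hP
      split_ifs with hc
      · rw [straightenCoeff_attachSeq_bot hc.1.2, hr.quiverCoeff_shift hg mu hm1, hm0, hs0, hs1, ht0,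
          ht1, hm1, lrCoeff_bot]
        simp
      -- The size and length restrictions discard no nonzero term: a nonzero `lrCoeff g a b` forces
      -- the sizes to add up and `a` to be no longer than `g`, hence of length at most `h`.
      · by_contra hne
        have hne := Ne.symm hne
        have ha : a.colLen 0 ≤ g.colLen 0 :=
          not_lt.1 fun hlt => hne (lrCoeff_eq_zero_of_colLen_lt hlt b)
        refine hc ⟨⟨?_, ?_⟩, ?_, ?_⟩
        · rw [hs0, ht0, hm0, card_eq_of_lrCoeff_ne_zero hne]
        · rw [hs0]
          exact ha.trans (colLen_le_of_le_rect hg)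
        · rw [hs1, ht1, hm1]
          simp [YoungDiagram.card]
        · rw [hs1, colLen_bot]
    · rw [if_neg hP]
      by_contra hne
      obtain ⟨hc, hne⟩ := ite_ne_right_iff.1 hne
      have hs1 := eq_bot_of_colLen hc.2.2
      rw [straightenCoeff_attachSeq_bot hc.1.2, hs1, lrCoeff_bot] at hne
      simp only [mul_ne_zero_iff, ite_ne_right_iff] at hne
      obtain ⟨⟨hq, -, hm, -⟩, ⟨⟨hs0, -⟩, ht0, -⟩, ht1, -⟩ := hne
      have hm1 := hm.symm.trans ht1
      rw [hr.quiverCoeff_shift hg mu hm1] at hq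
      exact hP ⟨⟨(ite_ne_right_iff.1 hq).1, hm1⟩, ⟨hs0, hs1⟩, ht0, ht1⟩
  rw [quiverCoeff]
  refine (finsum_congr fun mu => finsum_congr fun s => finsum_congr fun t => hterm mu s t).trans ?_
  rw [finsum_finsum_finsum_eq_single _ ![g, rotCompl h w g] ![a, ⊥] ![b, rotCompl h w g]]
  · simp
  · intro mu s t hne
    obtain ⟨h1, h2, h3⟩ := (ite_ne_right_iff.1 hne).1
    refine ⟨funext fun i => ?_, funext fun i => ?_, funext fun i => ?_⟩ <;>
      fin_cases i <;> simp [*]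

theorem exists_realizesArray (h w : ℕ) : ∃ r, RealizesArray h w r := by
  -- These are the ranks of an injection, an isomorphism and a surjection between spaces of
  -- dimensions `w`, `h + w`, `h + w`, `h`, with total composite zero.
  refine ⟨fun i j => if i = 0 then (if j ≤ 2 then w else 0) else if j = 3 then h else h + w,
    ⟨?_, ?_⟩, ?_, ?_, ?_, ?_, ?_, ?_⟩
  · intro i j hij hj
    have hi : i < 3 := by omega
    interval_cases j <;> interval_cases i <;> simp_all
  · intro i j hij hj
    have hi : i < 2 := by omega
    interval_cases j <;> interval_cases i <;> simp_all
  all_goals simp [rectHeight, rectWidth]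

end QuiverLR

theorem mainTheorem6 (α β γ : YoungDiagram) (h w : ℕ) (hγ : γ ≤ QuiverLR.rect h w) :
    (∃ r : ℕ → ℕ → ℕ, QuiverLR.RealizesArray h w r) ∧
    ∀ r : ℕ → ℕ → ℕ, QuiverLR.RealizesArray h w r →
      QuiverLR.lrCoeff γ α β =
        QuiverLR.quiverCoeff 3 r ![α, β, QuiverLR.rotCompl h w γ] :=
  ⟨QuiverLR.exists_realizesArray h w, fun _ hr => (hr.quiverCoeff_eq hγ α β).symm⟩
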